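/- Let $n\ge 3$ and let $2\le d_1\le d_2\le\cdots\le d_n$ be integers with $d_n\le d_1d_2\cdots d_{n-1}$. For each $k$ let $\lambda^{(k)}_1,\dots,\lambda^{(k)}_{d_k^2-1}$ be generators of $SU(d_k)$, that is, complex $d_k\times d_k$ matrices with $(\lambda^{(k)}_i)^\dagger=\lambda^{(k)}_i$, $\operatorname{Tr}\lambda^{(k)}_i=0$ and $\operatorname{Tr}(\lambda^{(k)}_i\lambda^{(k)}_j)=2\delta_{ij}$. Let $\rho$ be an $n$-partite (pure or mixed) quantum state on $\mathbb C^{d_1}\otimes\cdots\otimes\mathbb C^{d_n}$, i.e. a positive semidefinite matrix of trace one, and let $\mathbf T^{(12\cdots n)}$ be its full correlation tensor, with entries $t_{i_1\cdots i_n}=\operatorname{Tr}\big(\rho\,\lambda^{(1)}_{i_1}\otimes\cdots\otimes\lambda^{(n)}_{i_n}\big)$ for $1\le i_k\le d_k^2-1$, and squared norm $\|\mathbf T^{(12\cdots n)}\|^2=\sum_{i_1,\dots,i_n}t_{i_1\cdots i_n}^2$. Then $$\left\|\mathbf T^{(12\cdots n)}\right\|^{2}\le 2^{n}\left\{1-\frac{\sum_{1\le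 i_1<\cdots<i_{n-1}\le n}d_{i_1}\cdots d_{i_{n-1}}-\sum_{i=1}^{n}d_i+(n-2)d_n}{(n-2)\,d_1\cdots d_{n-1}\,d_n^{2}}\right\}.$$ -/

import Mathlib

open scoped Matrix ComplexOrder

namespace BlochNorm

/-- A density matrix: a positive semidefinite complex matrix of trace one. -/
structure IsState {ι : Type*} [Fintype ι] (ρ : Matrix ι ι ℂ) : Prop where
  posSemidef : ρ.PosSemidef
  trace_eq_one : ρ.trace = 1

/-- A family of generators of `SU(d)`: `d ^ 2 - 1` traceless Hermitian matrices of size `d`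
with `Tr (g i * g j) = 2 δ_ij`. -/
structure IsGenerators {d : ℕ} (g : Fin (d ^ 2 - 1) → Matrix (Fin d) (Fin d) ℂ) : Prop where
  hermitian : ∀ i, (g i)ᴴ = g i
  trace_eq_zero : ∀ i, (g i).trace = 0
  trace_mul : ∀ i j, (g i * g j).trace = if i = j then 2 else 0

/-- The tensor (Kronecker) product `A 1 ⊗ ⋯ ⊗ A n` of square matrices, in the product basis of
`ℂ^{d 1} ⊗ ⋯ ⊗ ℂ^{d n}`, which is indexed by the tuples `a` with `a k : Fin (d k)`. -/
def tensorProd {n : ℕ} {d : Fin n → ℕ} (A : ∀ k, Matrix (Fin (d k)) (Fin (d k)) ℂ) :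
    Matrix (∀ k, Fin (d k)) (∀ k, Fin (d k)) ℂ :=
  Matrix.of fun a b => ∏ k, A k (a k) (b k)

/-- The full correlation tensor of `ρ`, with entries
`Tr (ρ (g 1 (i 1) ⊗ ⋯ ⊗ g n (i n)))`, as a vector with the Euclidean norm. -/
noncomputable def corrTensor {n : ℕ} {d : Fin n → ℕ}
    (g : ∀ k, Fin (d k ^ 2 - 1) → Matrix (Fin (d k)) (Fin (d k)) ℂ)
    (ρ : Matrix (∀ k, Fin (d k)) (∀ k, Fin (d k)) ℂ) :
    EuclideanSpace ℂ (∀ k, Fin (d k ^ 2 - 1)) :=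
  WithLp.toLp 2 fun i => (ρ * tensorProd fun k => g k (i k)).trace

/-- The index of the last subsystem. -/
def lastIdx {n : ℕ} (hn : 3 ≤ n) : Fin n := ⟨n - 1, by omega⟩

end BlochNorm

/-! Rescaled and completed by the identity, the generators form orthonormal operator bases of the
factors, so `ρ` has squared coefficients `w i` indexed by tuples in which `none` marks the identity.
The correlation tensor carries exactly the weight `W` of the tuples without `none`, up to the factor
`2 ^ n`.

For `ρ = v v*` with squared trace `M`, the weights sum to `M`, and the all-`none` weight is `w₀ = M
/ D`, where `D = ∏ d k`. Let `F k` be the weight of tuples that are `none` at `k`, and `G k` that of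
tuples `none` away from `k`. Complementary subsystems of a pure state have equal purity, so `d k * F
k = (D / d k) * G k` (`mul_sum_weight_eq`). Counting identity factors (`sum_weight_counting`) gives
`(n - 2) W ≤ (n - 2) M - ∑ (F k - G k) - (n - 2) w₀`, and `G k ≥ w₀` bounds each `F k - G k` below.
Mixed states follow by convexity of the norm. -/

namespace BlochNorm

/-! ### Orthonormal operator bases and their kernels -/

/-- The elements `1 / √d` and `g i / √2`: an orthonormal basis of the `d × d` matrices for the
Hilbert-Schmidt inner product. -/
noncomputable def onBasis {d : ℕ} (g : Fin (d ^ 2 - 1) → Matrix (Fin d) (Fin d) ℂ) :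
    Option (Fin (d ^ 2 - 1)) → Matrix (Fin d) (Fin d) ℂ
  | none => ((√(d : ℝ))⁻¹ : ℂ) • 1
  | some i => ((√(2 : ℝ))⁻¹ : ℂ) • g i

theorem inv_sqrt_mul_inv_sqrt {x : ℝ} (hx : 0 ≤ x) :
    ((√x : ℝ) : ℂ)⁻¹ * ((√x : ℝ) : ℂ)⁻¹ = (x : ℂ)⁻¹ := by
  rw [← mul_inv, ← Complex.ofReal_mul, Real.mul_self_sqrt hx]

theorem ofReal_norm_sq (z : ℂ) : ((‖z‖ ^ 2 : ℝ) : ℂ) = z * star z := by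
  rw [← starRingEnd_apply, Complex.mul_conj']
  push_cast
  rfl

theorem onBasis_hermitian {d : ℕ} {g : Fin (d ^ 2 - 1) → Matrix (Fin d) (Fin d) ℂ}
    (hg : IsGenerators g) (i : Option (Fin (d ^ 2 - 1))) : (onBasis g i)ᴴ = onBasis g i := by
  cases i <;> simp [onBasis, Matrix.conjTranspose_smul, hg.hermitian]

theorem onBasis_trace_mul {d : ℕ} (hd : 0 < d)
    {g : Fin (d ^ 2 - 1) → Matrix (Fin d) (Fin d) ℂ} (hg : IsGenerators g)
    (i j : Option (Fin (d ^ 2 - 1))) :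
    (onBasis g i * onBasis g j).trace = if i = j then 1 else 0 := by
  have hd' : (d : ℂ) ≠ 0 := by exact_mod_cast hd.ne'
  have h1 := inv_sqrt_mul_inv_sqrt (Nat.cast_nonneg (α := ℝ) d)
  have h2 := inv_sqrt_mul_inv_sqrt (zero_le_two (α := ℝ))
  push_cast at h1 h2
  cases i <;> cases j <;>
    simp [onBasis, hg.trace_eq_zero, hg.trace_mul, Matrix.trace_smul, ← mul_assoc]
  · rw [h1, inv_mul_cancel₀ hd']
  · rw [h2]
    split_ifs <;> simp

/-- The completeness relation of an orthonormal basis of Hermitian matrices. -/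
theorem onBasis_complete {d : ℕ} (hd : 0 < d)
    {g : Fin (d ^ 2 - 1) → Matrix (Fin d) (Fin d) ℂ} (hg : IsGenerators g) (a b a' b' : Fin d) :
    ∑ i, onBasis g i b a * star (onBasis g i b' a') =
      if a = a' ∧ b = b' then 1 else 0 := by
  let U : Matrix (Option (Fin (d ^ 2 - 1))) (Fin d × Fin d) ℂ :=
    Matrix.of fun i p => star (onBasis g i p.1 p.2)
  have hU : U * Uᴴ = 1 := by
    ext i j
    have h := onBasis_trace_mul hd hg i j
    rw [Matrix.one_apply, ← h, Matrix.mul_apply, Fintype.sum_prod_type, Matrix.trace,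
      Finset.sum_comm]
    refine Finset.sum_congr rfl fun x _ => ?_
    rw [Matrix.diag_apply, Matrix.mul_apply]
    refine Finset.sum_congr rfl fun y _ => ?_
    simp only [U, Matrix.of_apply, Matrix.conjTranspose_apply, star_star]
    rw [← Matrix.conjTranspose_apply, onBasis_hermitian hg]
  -- `U` is square because `1 + (d ^ 2 - 1) = d ^ 2` for `d > 0`. Orthonormal rows then force
  -- orthonormal columns, which is completeness.
  have hcard : Fintype.card (Option (Fin (d ^ 2 - 1))) = Fintype.card (Fin d × Fin d) := by
    have : 0 < d ^ 2 := by positivity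
    simp [← sq]
    omega
  rw [Matrix.mul_eq_one_comm_of_card_eq _ _ _ hcard] at hU
  have h := congrFun (congrFun hU (b, a)) (b', a')
  simp only [U, Matrix.mul_apply, Matrix.conjTranspose_apply, Matrix.of_apply, star_star,
    Matrix.one_apply, Prod.mk.injEq] at h
  rw [h]
  simp only [and_comm]

/-- Up to `1 / d`, this is the completeness kernel with `b` and `a'` exchanged; the equality of
complementary purities rests on this exchange. -/
theorem onBasis_none_kernel {d : ℕ} (g : Fin (d ^ 2 - 1) → Matrix (Fin d) (Fin d) ℂ)
    (a b a' b' : Fin d) :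
    onBasis g none b a * star (onBasis g none b' a') =
      (d : ℂ)⁻¹ * if a = b ∧ a' = b' then 1 else 0 := by
  have h1 := inv_sqrt_mul_inv_sqrt (Nat.cast_nonneg (α := ℝ) d)
  push_cast at h1
  simp only [onBasis, Matrix.smul_apply, Matrix.one_apply, smul_eq_mul, star_mul', star_inv₀]
  rw [← h1]
  simp only [@eq_comm _ b a, @eq_comm _ b' a']
  by_cases h : a = b <;> by_cases h' : a' = b' <;> simp [h, h']

/-! ### Weights and purities of pure states -/

/-- The sum of squared correlations over a box of indices, expanded in matrix entries. -/
theorem sum_piFinset_sq_trace {n : ℕ} {d : Fin n → ℕ} {κ : Fin n → Type*}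
    (B : ∀ k, κ k → Matrix (Fin (d k)) (Fin (d k)) ℂ) (s : ∀ k, Finset (κ k))
    (ρ : Matrix (∀ k, Fin (d k)) (∀ k, Fin (d k)) ℂ) :
    ((∑ i ∈ Fintype.piFinset s, ‖(ρ * tensorProd fun k => B k (i k)).trace‖ ^ 2 : ℝ) : ℂ) =
      ∑ a, ∑ b, ∑ a', ∑ b', ρ a b * star (ρ a' b') *
        ∏ k, ∑ j ∈ s k, B k j (b k) (a k) * star (B k j (b' k) (a' k)) := by
  have h : ∀ i : ∀ k, κ k, ((‖(ρ * tensorProd fun k => B k (i k)).trace‖ ^ 2 : ℝ) : ℂ) =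
      ∑ a, ∑ b, ∑ a', ∑ b', ρ a b * star (ρ a' b') *
        ∏ k, (B k (i k) (b k) (a k) * star (B k (i k) (b' k) (a' k))) := by
    intro i
    have h0 : (ρ * tensorProd fun k => B k (i k)).trace =
        ∑ a, ∑ b, ρ a b * ∏ k, B k (i k) (b k) (a k) := by
      simp [Matrix.trace, Matrix.mul_apply, tensorProd]
    rw [ofReal_norm_sq, h0, star_sum, Finset.sum_mul]
    refine Finset.sum_congr rfl fun a _ => ?_
    rw [Finset.sum_mul]
    refine Finset.sum_congr rfl fun b _ => ?_
    rw [Finset.mul_sum]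
    refine Finset.sum_congr rfl fun a' _ => ?_
    rw [star_sum, Finset.mul_sum]
    refine Finset.sum_congr rfl fun b' _ => ?_
    rw [star_mul', star_prod, Finset.prod_mul_distrib]
    ring
  rw [Complex.ofReal_sum, Finset.sum_congr rfl fun i _ => h i, Finset.sum_comm]
  refine Finset.sum_congr rfl fun a _ => ?_
  rw [Finset.sum_comm]
  refine Finset.sum_congr rfl fun b _ => ?_
  rw [Finset.sum_comm]
  refine Finset.sum_congr rfl fun a' _ => ?_
  rw [Finset.sum_comm]
  refine Finset.sum_congr rfl fun b' _ => ?_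
  rw [Finset.prod_univ_sum, Finset.mul_sum]

/-- The squared coefficient of a matrix along a tensor product of orthonormal basis elements. -/
noncomputable def weight {n : ℕ} {d : Fin n → ℕ}
    (g : ∀ k, Fin (d k ^ 2 - 1) → Matrix (Fin (d k)) (Fin (d k)) ℂ)
    (ρ : Matrix (∀ k, Fin (d k)) (∀ k, Fin (d k)) ℂ)
    (i : ∀ k, Option (Fin (d k ^ 2 - 1))) : ℝ :=
  ‖(ρ * tensorProd fun k => onBasis (g k) (i k)).trace‖ ^ 2

section

variable {n : ℕ} {d : Fin n → ℕ} {g : ∀ k, Fin (d k ^ 2 - 1) → Matrix (Fin (d k)) (Fin (d k)) ℂ}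

theorem weight_nonneg (ρ : Matrix (∀ k, Fin (d k)) (∀ k, Fin (d k)) ℂ)
    (i : ∀ k, Option (Fin (d k ^ 2 - 1))) : 0 ≤ weight g ρ i := sq_nonneg _

theorem weight_none (ρ : Matrix (∀ k, Fin (d k)) (∀ k, Fin (d k)) ℂ) :
    weight g ρ (fun _ => none) = (∏ k, (d k : ℝ))⁻¹ * ‖ρ.trace‖ ^ 2 := by
  have h : (tensorProd fun k => onBasis (g k) none) =
      ((∏ k, (√(d k : ℝ))⁻¹ : ℝ) : ℂ) • (1 : Matrix (∀ k, Fin (d k)) (∀ k, Fin (d k)) ℂ) := by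
    ext a b
    simp only [tensorProd, onBasis, Matrix.of_apply, Matrix.smul_apply, smul_eq_mul,
      Finset.prod_mul_distrib]
    congr 1
    · push_cast
      rfl
    · simp only [Matrix.one_apply]
      rw [Fintype.prod_ite_zero]
      simp [funext_iff]
  rw [weight, h, Matrix.mul_smul, mul_one, Matrix.trace_smul, smul_eq_mul, norm_mul, mul_pow,
    Complex.norm_real, Real.norm_eq_abs, sq_abs, ← Finset.prod_pow]
  simp

/-- Parseval: the weights add up to the squared Hilbert-Schmidt norm, which for a rank-one `v v*` is
the squared trace. -/
theorem sum_weight (hd : ∀ k, 0 < d k) (hg : ∀ k, IsGenerators (g k))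
    (v : (∀ k, Fin (d k)) → ℂ) :
    ∑ i, weight g (Matrix.vecMulVec v (star v)) i = ‖(Matrix.vecMulVec v (star v)).trace‖ ^ 2 := by
  have h := sum_piFinset_sq_trace (fun k => onBasis (g k)) (fun _ => Finset.univ)
    (Matrix.vecMulVec v (star v))
  rw [← Complex.ofReal_inj]
  simp only [Fintype.piFinset_univ] at h
  simp only [weight]
  rw [h]
  have hk : ∀ a b a' b' : ∀ k, Fin (d k),
      (∏ k, ∑ j, onBasis (g k) j (b k) (a k) * star (onBasis (g k) j (b' k) (a' k))) =
        if a = a' then if b = b' then (1 : ℂ) else 0 else 0 := by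
    intro a b a' b'
    rw [Finset.prod_congr rfl fun k _ => onBasis_complete (hd k) (hg k) _ _ _ _,
      Fintype.prod_ite_zero]
    simp only [forall_and, ← funext_iff, Finset.prod_const_one, ite_and]
  simp only [hk]
  rw [ofReal_norm_sq]
  simp only [mul_ite, mul_one, mul_zero,
    Matrix.trace, Matrix.diag_apply, Matrix.vecMulVec_apply, Pi.star_apply, star_sum, star_mul',
    star_star]
  rw [Finset.sum_mul_sum]
  refine Finset.sum_congr rfl fun a _ => ?_
  have : ∀ b : ∀ k, Fin (d k), (∑ a', ∑ b', if a = a' then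
      (if b = b' then v a * star (v b) * (star (v a') * v b') else 0) else 0) =
      v a * star (v b) * (star (v a) * v b) := by
    intro b
    rw [Finset.sum_eq_single a]
    · simp
    · intro c _ hc
      simp [Ne.symm hc]
    · simp
  rw [Finset.sum_congr rfl fun b _ => this b]
  exact Finset.sum_congr rfl fun b _ => by ring

/-- For a pure state the purity of a subsystem equals the purity of its complement. -/
theorem mul_sum_weight_eq (hd : ∀ k, 0 < d k) (hg : ∀ k, IsGenerators (g k))
    (v : (∀ k, Fin (d k)) → ℂ) (k : Fin n) :
    (d k : ℝ) * ∑ i with i k = none, weight g (Matrix.vecMulVec v (star v)) i =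
      (∏ j ∈ Finset.univ.erase k, (d j : ℝ)) *
        ∑ i with ∀ j, j ≠ k → i j = none, weight g (Matrix.vecMulVec v (star v)) i := by
  classical
  let s : ∀ j, Finset (Option (Fin (d j ^ 2 - 1))) :=
    fun j => if j = k then {none} else Finset.univ
  let t : ∀ j, Finset (Option (Fin (d j ^ 2 - 1))) :=
    fun j => if j = k then Finset.univ else {none}
  have hs : (Finset.univ.filter fun i : ∀ j, Option (Fin (d j ^ 2 - 1)) => i k = none) =
      Fintype.piFinset s := by
    ext i
    simp only [Finset.mem_filter, Finset.mem_univ, true_and, Fintype.mem_piFinset, s]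
    refine ⟨fun h j => ?_, fun h => by simpa using h k⟩
    by_cases hj : j = k
    · subst hj; simpa using h
    · simp [hj]
  have ht : (Finset.univ.filter fun i : ∀ j, Option (Fin (d j ^ 2 - 1)) =>
      ∀ j, j ≠ k → i j = none) = Fintype.piFinset t := by
    ext i
    simp only [Finset.mem_filter, Finset.mem_univ, true_and, Fintype.mem_piFinset, t]
    refine forall_congr' fun j => ?_
    by_cases hj : j = k <;> simp [hj]
  rw [hs, ht, ← Complex.ofReal_inj, Complex.ofReal_mul, Complex.ofReal_mul]
  simp only [weight]
  rw [sum_piFinset_sq_trace (fun k => onBasis (g k)) s,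
    sum_piFinset_sq_trace (fun k => onBasis (g k)) t]
  -- Exchanging `b` and `a'` turns the kernel of the box `s` into that of `t`, factor by factor.
  have hker : ∀ a b a' b' : ∀ k, Fin (d k),
      (d k : ℂ) * (∏ j, ∑ l ∈ s j,
        onBasis (g j) l (b j) (a j) * star (onBasis (g j) l (b' j) (a' j))) =
      (∏ j ∈ Finset.univ.erase k, (d j : ℂ)) * (∏ j, ∑ l ∈ t j,
        onBasis (g j) l (a' j) (a j) * star (onBasis (g j) l (b' j) (b j))) := by
    intro a b a' b'
    rw [← Finset.mul_prod_erase _ _ (Finset.mem_univ k),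
      ← Finset.mul_prod_erase _ _ (Finset.mem_univ k), ← mul_assoc, mul_left_comm,
      ← Finset.prod_mul_distrib]
    have hc : ∀ j, (d j : ℂ) ≠ 0 := fun j => by exact_mod_cast (hd j).ne'
    congr 1
    · simp only [s, t, if_true, Finset.sum_singleton]
      rw [onBasis_none_kernel, onBasis_complete (hd k) (hg k), mul_inv_cancel_left₀ (hc k)]
    · refine Finset.prod_congr rfl fun j hj => ?_
      have hj := Finset.ne_of_mem_erase hj
      simp only [s, t, if_neg hj, Finset.sum_singleton]
      rw [onBasis_none_kernel, onBasis_complete (hd j) (hg j), mul_inv_cancel_left₀ (hc j)]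
  push_cast
  simp only [Finset.mul_sum]
  refine Finset.sum_congr rfl fun a _ => ?_
  -- The product `v a * star (v b) * star (v a') * v b'` is symmetric in `b` and `a'`, so these two
  -- summation variables can trade places.
  rw [Finset.sum_comm]
  refine Finset.sum_congr rfl fun a' _ => Finset.sum_congr rfl fun b _ =>
    Finset.sum_congr rfl fun b' _ => ?_
  rw [mul_left_comm, hker, mul_left_comm]
  simp only [Matrix.vecMulVec_apply, Pi.star_apply, star_mul', star_star]
  ring

end

/-! ### Counting identity factors -/

/-- Split by the number of entries different from `none`. With 0, 1 or `n` of them both sides agree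
(`n`, `n - 1`, `n - 2`); otherwise at least two entries differ from `none`, so the left side is at
most `n - 2`. -/
theorem card_none_add_le {n : ℕ} (hn : 2 ≤ n) {κ : Fin n → Type*} (i : ∀ k, Option (κ k))
    [DecidablePred fun k => i k = none] [Decidable (∀ k, i k ≠ none)] [Decidable (∀ k, i k = none)]
    [∀ k, Decidable (∀ j, j ≠ k → i j = none)] :
    (∑ k, if i k = none then (1 : ℝ) else 0) +
        ((n : ℝ) - 2) * (if ∀ k, i k ≠ none then 1 else 0) ≤
      ((n : ℝ) - 2) + ∑ k, ((if ∀ j, j ≠ k → i j = none then (1 : ℝ) else 0) -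
        (if ∀ j, i j = none then 1 else 0)) + 2 * (if ∀ k, i k = none then 1 else 0) := by
  by_cases h0 : ∀ k, i k = none
  · have : ¬ ∀ k, i k ≠ none := fun h => h ⟨0, by omega⟩ (h0 _)
    rw [if_neg this]
    simp [h0]
  have hpos : ∀ k, 0 ≤ (if ∀ j, j ≠ k → i j = none then (1 : ℝ) else 0) := fun k => by
    split_ifs <;> norm_num
  have hsum := Finset.sum_nonneg fun k (_ : k ∈ Finset.univ) => hpos k
  simp only [h0, if_false, sub_zero, mul_zero, add_zero]
  by_cases h1 : ∀ k, i k ≠ none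
  · rw [if_pos h1, Finset.sum_eq_zero fun k _ => if_neg (h1 k)]
    linarith
  simp only [h1, if_false, mul_zero, add_zero, Finset.sum_boole]
  have hcard := Finset.card_filter_add_card_filter_not (s := (Finset.univ : Finset (Fin n)))
    (fun k => i k = none)
  rw [Finset.card_univ, Fintype.card_fin] at hcard
  have hcard' : ((Finset.univ.filter fun k => i k = none).card : ℝ) +
      ((Finset.univ.filter fun k => ¬ i k = none).card : ℝ) = n := by exact_mod_cast hcard
  push Not at h0
  obtain ⟨k, hk⟩ := h0
  by_cases h2 : ∀ j, j ≠ k → i j = none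
  · have h3 := Finset.single_le_sum (fun k _ => hpos k) (Finset.mem_univ k)
    simp only [Finset.sum_boole] at h3
    rw [if_pos h2] at h3
    have h4 : (1 : ℝ) ≤ ((Finset.univ.filter fun k => ¬ i k = none).card : ℝ) := by
      exact_mod_cast Finset.card_pos.mpr ⟨k, by simpa using hk⟩
    linarith
  · push Not at h2
    obtain ⟨j, hjk, hj⟩ := h2
    have h4 : (2 : ℝ) ≤ ((Finset.univ.filter fun k => ¬ i k = none).card : ℝ) := by
      have := Finset.one_lt_card (s := Finset.univ.filter fun k => ¬ i k = none) |>.mpr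
        ⟨j, by simpa using hj, k, by simpa using hk, hjk⟩
      exact_mod_cast this
    simp only [Finset.sum_boole] at hsum
    linarith

/-- Counting the factors on which each multi-index is `none`. -/
theorem sum_weight_counting {n : ℕ} (hn : 2 ≤ n) {κ : Fin n → Type*} [∀ k, Fintype (κ k)]
    [∀ k, DecidableEq (κ k)] (w : (∀ k, Option (κ k)) → ℝ) (hw : ∀ i, 0 ≤ w i) :
    (∑ k, ∑ i with i k = none, w i) + ((n : ℝ) - 2) * ∑ i : ∀ k, κ k, w (fun k => some (i k)) ≤
      ((n : ℝ) - 2) * ∑ i, w i +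
        (∑ k, ((∑ i with ∀ j, j ≠ k → i j = none, w i) - w (fun _ => none))) +
        2 * w (fun _ => none) := by
  classical
  have hsome : ∑ i : ∀ k, κ k, w (fun k => some (i k)) =
      ∑ i, w i * (if ∀ k, i k ≠ none then 1 else 0) := by
    simp only [mul_ite, mul_one, mul_zero]
    rw [← Finset.sum_filter]
    refine Finset.sum_bij (fun i _ k => some (i k)) (by simp) ?_ ?_ (by simp)
    · intro a _ b _ h
      funext k
      exact Option.some_injective _ (congrFun h k)
    · intro i hi
      simp only [Finset.mem_filter, Finset.mem_univ, true_and] at hi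
      exact ⟨fun k => (i k).get (Option.isSome_iff_ne_none.mpr (hi k)), Finset.mem_univ _,
        by simp⟩
  have hnone : w (fun _ => none) = ∑ i, w i * (if ∀ k, i k = none then 1 else 0) := by
    simp only [mul_ite, mul_one, mul_zero]
    rw [Finset.sum_eq_single (fun _ => none)]
    · simp
    · intro i _ hi
      rw [if_neg fun h => hi (funext h)]
    · simp
  rw [hsome, hnone]
  simp only [Finset.sum_filter]
  have key := Finset.sum_le_sum fun i (_ : i ∈ Finset.univ) =>
    mul_le_mul_of_nonneg_left (card_none_add_le hn i) (hw i)
  simp only [mul_add, Finset.sum_add_distrib] at key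
  have e1 : ∑ i, w i * ∑ k, (if i k = none then (1 : ℝ) else 0) =
      ∑ k, ∑ i, if i k = none then w i else 0 := by
    rw [Finset.sum_comm]
    simp only [Finset.mul_sum, mul_ite, mul_one, mul_zero]
  have e2 : ∑ i, w i * ∑ k, ((if ∀ j, j ≠ k → i j = none then (1 : ℝ) else 0) -
        (if ∀ j, i j = none then 1 else 0)) =
      ∑ k, ((∑ i, if ∀ j, j ≠ k → i j = none then w i else 0) -
        ∑ i, w i * (if ∀ j, i j = none then 1 else 0)) := by
    simp only [← Finset.sum_sub_distrib]
    rw [Finset.sum_comm]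
    simp only [Finset.mul_sum, mul_sub, mul_ite, mul_one, mul_zero]
  rw [e1, e2] at key
  simp only [mul_left_comm (w _), ← Finset.mul_sum, ← Finset.sum_mul] at key
  linarith

theorem sum_powersetCard_pred_prod {n : ℕ} (hn : 1 ≤ n) (f : Fin n → ℝ) :
    ∑ S ∈ Finset.powersetCard (n - 1) Finset.univ, ∏ k ∈ S, f k =
      ∑ k, ∏ j ∈ Finset.univ.erase k, f j := by
  symm
  refine Finset.sum_bij (fun k _ => Finset.univ.erase k) ?_ ?_ ?_ (by simp)
  · intro k _
    simp [Finset.mem_powersetCard, Finset.card_erase_of_mem]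
  · intro a _ b _ h
    by_contra hab
    have : a ∈ Finset.univ.erase b := by simp [hab]
    rw [← h] at this
    simp at this
  · intro S hS
    rw [Finset.mem_powersetCard] at hS
    have : Sᶜ.card = 1 := by
      rw [Finset.card_compl, hS.2, Fintype.card_fin]
      omega
    obtain ⟨k, hk⟩ := Finset.card_eq_one.mp this
    refine ⟨k, Finset.mem_univ _, ?_⟩
    rw [← compl_compl S, hk]
    ext j
    simp

/-! ### The bound for pure states -/

/-- The squared norm of the correlation tensor in terms of the full-support coefficients. -/
theorem norm_corrTensor_sq {n : ℕ} {d : Fin n → ℕ}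
    (g : ∀ k, Fin (d k ^ 2 - 1) → Matrix (Fin (d k)) (Fin (d k)) ℂ)
    (ρ : Matrix (∀ k, Fin (d k)) (∀ k, Fin (d k)) ℂ) :
    ‖corrTensor g ρ‖ ^ 2 = 2 ^ n * ∑ i : ∀ k, Fin (d k ^ 2 - 1), weight g ρ fun k => some (i k) := by
  rw [EuclideanSpace.norm_sq_eq, Finset.mul_sum]
  refine Finset.sum_congr rfl fun i _ => ?_
  have h : (tensorProd fun k => onBasis (g k) (some (i k))) =
      (((√(2 : ℝ))⁻¹ ^ n : ℝ) : ℂ) • tensorProd fun k => g k (i k) := by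
    ext a b
    simp [tensorProd, onBasis, Finset.prod_mul_distrib]
  rw [weight, h, Matrix.mul_smul, Matrix.trace_smul, smul_eq_mul, norm_mul, mul_pow,
    Complex.norm_real, Real.norm_eq_abs, sq_abs, ← pow_mul, mul_comm n 2, pow_mul, inv_pow,
    Real.sq_sqrt zero_le_two, inv_pow, mul_inv_cancel_left₀ (by positivity)]
  rfl

/-- The bound on the coefficient of full support, for an unnormalized pure state. -/
theorem norm_corrTensor_sq_le_of_pure {n : ℕ} (hn : 3 ≤ n) {d : Fin n → ℕ} (hd : ∀ k, 0 < d k)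
    (l : Fin n) (hle : ∀ k, d k ≤ d l) (hl : d l ≤ ∏ k ∈ Finset.univ.erase l, d k)
    {g : ∀ k, Fin (d k ^ 2 - 1) → Matrix (Fin (d k)) (Fin (d k)) ℂ}
    (hg : ∀ k, IsGenerators (g k)) (v : (∀ k, Fin (d k)) → ℂ) :
    ‖corrTensor g (Matrix.vecMulVec v (star v))‖ ^ 2 ≤
      (2 : ℝ) ^ n *
        (1 - ((∑ k, ∏ j ∈ Finset.univ.erase k, (d j : ℝ)) - (∑ k, (d k : ℝ)) +
            ((n : ℝ) - 2) * (d l : ℝ)) /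
          (((n : ℝ) - 2) * (∏ k ∈ Finset.univ.erase l, (d k : ℝ)) * (d l : ℝ) ^ 2)) *
        ‖(Matrix.vecMulVec v (star v)).trace‖ ^ 2 := by
  rw [norm_corrTensor_sq, mul_assoc]
  refine mul_le_mul_of_nonneg_left ?_ (by positivity)
  have hcount := sum_weight_counting (by omega) (weight g (Matrix.vecMulVec v (star v)))
    (weight_nonneg _)
  have hpur := mul_sum_weight_eq hd hg v
  have hnone := weight_none (g := g) (Matrix.vecMulVec v (star v))
  have hG : ∀ k, weight g (Matrix.vecMulVec v (star v)) (fun _ => none) ≤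
      ∑ i with ∀ j, j ≠ k → i j = none, weight g (Matrix.vecMulVec v (star v)) i := fun k =>
    Finset.single_le_sum (f := weight g (Matrix.vecMulVec v (star v)))
      (fun i _ => weight_nonneg _ i) (by simp)
  rw [sum_weight hd hg] at hcount
  simp only [Finset.sum_sub_distrib, Finset.sum_const, Finset.card_univ, Fintype.card_fin,
    nsmul_eq_mul] at hcount
  have hM : 0 ≤ ‖(Matrix.vecMulVec v (star v)).trace‖ ^ 2 := sq_nonneg _
  rw [← Finset.mul_prod_erase _ _ (Finset.mem_univ l)] at hnone
  have hD : ∀ k, (d k : ℝ) * ∏ j ∈ Finset.univ.erase k, (d j : ℝ) =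
      d l * ∏ j ∈ Finset.univ.erase l, (d j : ℝ) := fun k => by
    rw [Finset.mul_prod_erase _ (fun j => (d j : ℝ)) (Finset.mem_univ k),
      Finset.mul_prod_erase _ (fun j => (d j : ℝ)) (Finset.mem_univ l)]
  have hl' : (d l : ℝ) ≤ ∏ k ∈ Finset.univ.erase l, (d k : ℝ) := by exact_mod_cast hl
  have hpos : ∀ k, (0 : ℝ) < d k := fun k => by exact_mod_cast hd k
  have hle' : ∀ k, (d k : ℝ) ≤ d l := fun k => by exact_mod_cast hle k
  have hn' : (0 : ℝ) < (n : ℝ) - 2 := by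
    have : (3 : ℝ) ≤ n := by exact_mod_cast hn
    linarith
  generalize ‖(Matrix.vecMulVec v (star v)).trace‖ ^ 2 = M at *
  generalize hF : (fun k => ∑ i with i k = none, weight g (Matrix.vecMulVec v (star v)) i) = F at *
  generalize hGdef : (fun k => ∑ i with ∀ j, j ≠ k → i j = none,
    weight g (Matrix.vecMulVec v (star v)) i) = G at *
  have hF' := congrFun hF
  have hG' := congrFun hGdef
  simp only [hF', hG'] at hcount hpur hG
  generalize hP : (∏ k ∈ Finset.univ.erase l, (d k : ℝ)) = P at *
  have hPpos : 0 < P := (hpos l).trans_le hl'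
  -- With `Q = D / d k`, the purity identity gives `F k - G k = (Q - d k) * G k / d k`. Since `Q ≥ d
  -- k`, lower `G k` to `w₀ = M / D` and raise the denominator to `d l`.
  have hterm : ∀ k, M * ((∏ j ∈ Finset.univ.erase k, (d j : ℝ)) - d k) / (d l * P * d l) ≤
      F k - G k := by
    intro k
    -- After multiplication by `d k` this reads `d k * d k ≤ d l * P`, which follows from `d k ≤ d l
    -- ≤ P`.
    have hQ : (d k : ℝ) ≤ ∏ j ∈ Finset.univ.erase k, (d j : ℝ) := by
      refine le_of_mul_le_mul_left ?_ (hpos k)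
      rw [hD k]
      exact mul_le_mul (hle' k) ((hle' k).trans hl') (hpos k).le (hpos l).le
    have hpk := hpur k
    generalize (∏ j ∈ Finset.univ.erase k, (d j : ℝ)) = Q at *
    have h1 : F k - G k = (Q - d k) * G k / d k := by
      rw [eq_div_iff (hpos k).ne']
      linarith
    have h2 : M / (d l * P) ≤ G k := by
      rw [div_eq_inv_mul, ← hnone]
      exact hG k
    have h3 : 0 ≤ M / (d l * P) := div_nonneg hM (mul_pos (hpos l) hPpos).le
    calc _ = (Q - d k) * (M / (d l * P)) / d l := by ring
      _ ≤ (Q - d k) * (M / (d l * P)) / d k :=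
        div_le_div_of_nonneg_left (mul_nonneg (sub_nonneg.mpr hQ) h3) (hpos k) (hle' k)
      _ ≤ (Q - d k) * G k / d k :=
        div_le_div_of_nonneg_right (mul_le_mul_of_nonneg_left h2 (sub_nonneg.mpr hQ)) (hpos k).le
      _ = _ := h1.symm
  have hsum := Finset.sum_le_sum fun k (_ : k ∈ Finset.univ) => hterm k
  rw [← Finset.sum_div, ← Finset.mul_sum, Finset.sum_sub_distrib, Finset.sum_sub_distrib] at hsum
  refine le_of_mul_le_mul_left ?_ hn'
  refine le_trans ?_ (le_of_eq (?_ : ((n : ℝ) - 2) * M -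
    M * ((∑ k, ∏ j ∈ Finset.univ.erase k, (d j : ℝ)) - ∑ k, (d k : ℝ)) / (d l * P * d l) -
      ((n : ℝ) - 2) * ((d l * P)⁻¹ * M) = _))
  · rw [hnone] at hcount
    linarith
  · have := (hpos l).ne'
    have := hPpos.ne'
    have := hn'.ne'
    field_simp
    ring

/-! ### From pure to mixed states -/

/-- Linearity of the correlation tensor. -/
theorem corrTensor_sum {n : ℕ} {d : Fin n → ℕ}
    (g : ∀ k, Fin (d k ^ 2 - 1) → Matrix (Fin (d k)) (Fin (d k)) ℂ) {ι : Type*} (s : Finset ι)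
    (ρ : ι → Matrix (∀ k, Fin (d k)) (∀ k, Fin (d k)) ℂ) :
    corrTensor g (∑ i ∈ s, ρ i) = ∑ i ∈ s, corrTensor g (ρ i) := by
  ext i
  simp [corrTensor, Finset.sum_mul, Matrix.trace_sum]

theorem trace_vecMulVec_star {ι : Type*} [Fintype ι] (v : ι → ℂ) :
    (Matrix.vecMulVec v (star v)).trace = (‖(Matrix.vecMulVec v (star v)).trace‖ : ℂ) := by
  have h : (Matrix.vecMulVec v (star v)).trace = ((∑ i, ‖v i‖ ^ 2 : ℝ) : ℂ) := by
    simp only [Matrix.trace, Matrix.diag_apply, Matrix.vecMulVec_apply, Pi.star_apply,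
      Complex.ofReal_sum, ofReal_norm_sq]
  rw [h, Complex.norm_real, Real.norm_of_nonneg (by positivity)]

/-- A quadratic bound on pure states extends to all states by the triangle inequality. -/
theorem norm_corrTensor_sq_le_of_forall_pure {n : ℕ} {d : Fin n → ℕ}
    (g : ∀ k, Fin (d k ^ 2 - 1) → Matrix (Fin (d k)) (Fin (d k)) ℂ) {C : ℝ}
    (hC : ∀ v, ‖corrTensor g (Matrix.vecMulVec v (star v))‖ ^ 2 ≤
      C * ‖(Matrix.vecMulVec v (star v)).trace‖ ^ 2)
    {ρ : Matrix (∀ k, Fin (d k)) (∀ k, Fin (d k)) ℂ} (hρ : IsState ρ) :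
    ‖corrTensor g ρ‖ ^ 2 ≤ C := by
  -- The vectors are unnormalized: the mixing probabilities are the traces of `v i (v i)*`, which
  -- sum to one.
  obtain ⟨m, v, rfl⟩ := Matrix.posSemidef_iff_eq_sum_vecMulVec.mp hρ.posSemidef
  have htr := hρ.trace_eq_one
  rw [Matrix.trace_sum, Finset.sum_congr rfl fun i _ => trace_vecMulVec_star (v i),
    ← Complex.ofReal_sum, Complex.ofReal_eq_one] at htr
  -- A negative `C` would force every `v i (v i)*` to have trace zero, against total trace one.
  have hC0 : 0 ≤ C := by
    by_contra! hneg
    have hz : ∀ i, ‖(Matrix.vecMulVec (v i) (star (v i))).trace‖ = 0 := by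
      intro i
      by_contra hi
      have : 0 < ‖(Matrix.vecMulVec (v i) (star (v i))).trace‖ ^ 2 := by positivity
      nlinarith [hC (v i), sq_nonneg ‖corrTensor g (Matrix.vecMulVec (v i) (star (v i)))‖]
    simp only [hz, Finset.sum_const_zero, zero_ne_one] at htr
  have hle : ‖corrTensor g (∑ i, Matrix.vecMulVec (v i) (star (v i)))‖ ≤ √C := by
    rw [corrTensor_sum]
    calc _ ≤ ∑ i, ‖corrTensor g (Matrix.vecMulVec (v i) (star (v i)))‖ := norm_sum_le _ _
      _ ≤ ∑ i, √C * ‖(Matrix.vecMulVec (v i) (star (v i))).trace‖ := by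
        refine Finset.sum_le_sum fun i _ => ?_
        refine le_of_sq_le_sq ?_ (by positivity)
        rw [mul_pow, Real.sq_sqrt hC0]
        exact hC _
      _ = √C := by rw [← Finset.mul_sum, htr, mul_one]
  calc _ ≤ √C ^ 2 := by gcongr
    _ = C := Real.sq_sqrt hC0

end BlochNorm

theorem theorem1 (n : ℕ) (hn : 3 ≤ n) (d : Fin n → ℕ)
    (hd2 : ∀ k, 2 ≤ d k) (hmono : Monotone d)
    (hlast : d (BlochNorm.lastIdx hn) ≤
      ∏ k ∈ Finset.univ.erase (BlochNorm.lastIdx hn), d k)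
    (g : ∀ k, Fin (d k ^ 2 - 1) → Matrix (Fin (d k)) (Fin (d k)) ℂ)
    (hg : ∀ k, BlochNorm.IsGenerators (g k))
    (ρ : Matrix (∀ k, Fin (d k)) (∀ k, Fin (d k)) ℂ)
    (hρ : BlochNorm.IsState ρ) :
    ‖BlochNorm.corrTensor g ρ‖ ^ 2 ≤
      (2 : ℝ) ^ n *
        (1 - ((∑ S ∈ Finset.powersetCard (n - 1) (Finset.univ : Finset (Fin n)),
                  ∏ k ∈ S, (d k : ℝ))
                - (∑ k, (d k : ℝ))
                + ((n : ℝ) - 2) * (d (BlochNorm.lastIdx hn) : ℝ)) /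
              (((n : ℝ) - 2)
                * (∏ k ∈ Finset.univ.erase (BlochNorm.lastIdx hn), (d k : ℝ))
                * (d (BlochNorm.lastIdx hn) : ℝ) ^ 2)) := by
  rw [BlochNorm.sum_powersetCard_pred_prod (by omega)]
  refine BlochNorm.norm_corrTensor_sq_le_of_forall_pure g (fun v => ?_) hρ
  refine BlochNorm.norm_corrTensor_sq_le_of_pure hn (fun k => by linarith [hd2 k]) _
    (fun k => hmono ?_) hlast hg v
  rw [Fin.le_def]
  have := k.isLt
  simp only [BlochNorm.lastIdx]
  omega
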